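/- Let $k$ be a perfect field, regarded as a discrete ring. A pseudocompact $k$-algebra is an associative unital Hausdorff topological $k$-algebra $A$ having a basis of neighbourhoods of $0$ consisting of open two-sided ideals $I$ of finite codimension, with $A\cong\varprojlim_I A/I$. Its radical $J(A)$ is the intersection of its maximal open left ideals, and $J^2(A)=J(A)J(A)$. The algebra $A$ is pointed if $A/J(A)$ is isomorphic to a product of copies of $k$. Let $\mathbf{PAlg}$ be the category whose objects are the pointed pseudocompact $k$-algebras $A$ with $A/J^2(A)$ finite dimensional, and whose morphisms are the continuous unital $k$-algebra homomorphisms $A\to B$ for which the induced map $A/J(A)\to B/J(B)$ is surjective. For $\alpha,\beta:A\to B$ in $\mathbf{PAlg}$ write $\alpha\sim_0\beta$ if $(\alpha-\beta)(A)\subseteq J(B)$; this is a congruence, and $\Pi_0:\mathbf{PAlg}\to\mathbf{PAlg}_0=\mathbf{PAlg}/{\sim_0}$ denotes the projection to the quotient category. Let $\mathbf{PSet}$ be the category whose objects are the finite pointed sets $Q_0^*=Q_0\sqcup\{*\}$, and whose morphisms $Q_0^*\to R_0^*$ are the pointed maps that restrict to a bijection from the set of elements of $Q_0$ not mapping to $*$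 onto $R_0$. Let $k_0[[-]]:\mathbf{PSet}\to\mathbf{PAlg}$ be the functor $Q_0^*\mapsto\prod_{e\in Q_0}k$ (with the discrete topology) that sends a morphism $\rho$ to the $k$-linear map with $e\mapsto\rho(e)$ if $\rho(e)\neq *$ and $e\mapsto 0$ otherwise (elements of $Q_0$ being identified with the standard basis vectors), and let $\widetilde{k}_0[[-]]=\Pi_0\circ k_0[[-]]$. For $A$ in $\mathbf{PAlg}$ let $\mathcal G(A)$ be the group of automorphisms $a\mapsto(1+w)a(1+w)^{-1}$ with $w\in J(A)$, and let $\mathrm{GQ}_0(A)$ be the set of $\mathcal G(A)$-orbits of (non-zero) primitive idempotents of $A$ together with an additional point $*$. For $\alpha:A\to B$ in $\mathbf{PAlg}$ let $\mathrm{GQ}_0(\alpha)$ fix $*$ and send the orbit of $e$ to the orbit of $\alpha(e)$ if $\alpha(e)\neq 0$ and to $*$ if $\alpha(e)=0$. This defines a functor $\mathrm{GQ}_0:\mathbf{PAlg}\to\mathbf{PSet}$, which factors uniquely as $\mathrm{GQ}_0=\widetilde{\mathrm{GQ}}_0\circ\Pi_0$. Then the functor $\widetilde{\mathrm{GQ}}_0:\mathbf{PAlg}_0\to\mathbf{PSet}$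 is left adjoint to the functor $\widetilde{k}_0[[-]]:\mathbf{PSet}\to\mathbf{PAlg}_0$. -/

import Mathlib

open CategoryTheory

universe u

set_option linter.unusedSectionVars false

noncomputable section

namespace PointedAlg

/-! ### Pseudocompact algebras and their radical -/

section Radical

variable (A : Type u) [Ring A] [TopologicalSpace A]

/-- The Jacobson radical of a topological algebra: the intersection of its maximal open left
ideals. (`Ideal A` is the type of left ideals of `A`.) -/
def radical : Ideal A := sInf {L : Ideal A | L.IsMaximal ∧ IsOpen (L : Set A)}

variable {A}

theorem mem_radical {x : A} :
    x ∈ radical A ↔ ∀ L : Ideal A, L.IsMaximal → IsOpen (L : Set A) → x ∈ L := by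
  simp [radical, Submodule.mem_sInf]

/-- The radical is a two-sided ideal. -/
instance radical_isTwoSided [IsTopologicalRing A] : (radical A).IsTwoSided := by
  refine ⟨fun {x} a hx => mem_radical.2 fun L hL hLo => ?_⟩
  let f : A →ₗ[A] A := LinearMap.toSpanSingleton A A a
  by_cases ha : a ∈ L
  · exact L.mul_mem_left x ha
  · have hmax : Ideal.IsMaximal (Submodule.comap f L) := by
      rw [Ideal.isMaximal_iff]
      refine ⟨by simpa [f] using ha, fun K y hK hy hyK => ?_⟩
      have hya : y * a ∉ L := by simpa [f] using hy
      obtain ⟨c, hc⟩ : ∃ c, a - c * (y * a) ∈ L := by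
        have h : a ∈ L ⊔ Ideal.span {y * a} := by
          have : L ⊔ Ideal.span {y * a} = ⊤ := by
            refine hL.1.2 _ (lt_of_le_of_ne le_sup_left fun h => hya ?_)
            rw [h]
            exact Ideal.mem_sup_right (Ideal.subset_span rfl)
          rw [this]; trivial
        obtain ⟨l, hl, z, hz, hlz⟩ := Submodule.mem_sup.1 h
        obtain ⟨c, rfl⟩ := Ideal.mem_span_singleton'.1 hz
        exact ⟨c, by rwa [show a - c * (y * a) = l from sub_eq_iff_eq_add.2 hlz.symm]⟩
      have h1 : (1 - c * y) ∈ K := hK (by simpa [f, sub_mul, mul_assoc] using hc)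
      simpa using K.add_mem h1 (K.mul_mem_left c hyK)
    have hopen : IsOpen (Submodule.comap f L : Set A) :=
      hLo.preimage (f := fun x : A => x * a) (continuous_id.mul continuous_const)
    exact mem_radical.1 hx _ hmax hopen

end Radical

section Pseudocompact

variable (k : Type u) [Field k] (A : Type u) [Ring A] [Algebra k A] [TopologicalSpace A]

/-- Pseudocompact `k`-algebras, for a discrete field `k`: Hausdorff topological algebras in which
the open (two-sided) ideals of finite codimension form a basis of neighbourhoods of `0` and for
which the canonical map to the inverse limit of the quotients by the open ideals is bijective
(it is injective since the space is Hausdorff, and surjectivity is `complete`). Continuity of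
scalar multiplication `k × A → A` is automatic, as `k` is discrete. -/
structure IsPseudocompact : Prop where
  isTopologicalRing : IsTopologicalRing A
  t2Space : T2Space A
  basis : (nhds (0 : A)).HasBasis
    (fun I : Ideal A => I.IsTwoSided ∧ IsOpen (I : Set A) ∧ Module.Finite k (A ⧸ I))
    (fun I => (I : Set A))
  complete : ∀ x : Ideal A → A,
    (∀ I K : Ideal A, I.IsTwoSided → K.IsTwoSided → IsOpen (I : Set A) → IsOpen (K : Set A) →
      I ≤ K → x I - x K ∈ K) →
    ∃ a : A, ∀ I : Ideal A, I.IsTwoSided → IsOpen (I : Set A) → a - x I ∈ I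

/-- The algebra is pointed: `A / J(A)` is isomorphic to a product of copies of `k`. -/
def IsPointed [IsTopologicalRing A] : Prop :=
  ∃ ι : Type u, Nonempty ((A ⧸ radical A) ≃ₐ[k] (ι → k))

end Pseudocompact

section Lemmas

variable {k : Type u} [Field k] {A : Type u} [Ring A] [Algebra k A] [TopologicalSpace A]
  [IsTopologicalRing A]

theorem IsPseudocompact.finite_quotient (h : IsPseudocompact k A) {I : Ideal A}
    (hI : IsOpen (I : Set A)) : Module.Finite k (A ⧸ I) := by
  obtain ⟨K, ⟨-, -, hK⟩, hKI⟩ := h.basis.mem_iff.1 (hI.mem_nhds I.zero_mem)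
  have hKI' : K ≤ I := hKI
  exact Module.Finite.of_surjective ((Submodule.factor hKI').restrictScalars k)
    (Submodule.factor_surjective hKI')

theorem IsPseudocompact.eq_zero (h : IsPseudocompact k A) {x : A}
    (hx : ∀ I : Ideal A, I.IsTwoSided → IsOpen (I : Set A) → x ∈ I) : x = 0 := by
  have := h.t2Space
  by_contra hne
  obtain ⟨K, ⟨h1, h2, -⟩, hK⟩ := h.basis.mem_iff.1
    (isOpen_compl_singleton.mem_nhds (show (0 : A) ∈ ({x} : Set A)ᶜ from fun h0 => hne h0.symm))
  exact hK (hx K h1 h2) rfl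

theorem IsPseudocompact.nilpotent_mod (h : IsPseudocompact k A) {x : A} (hx : x ∈ radical A)
    {I : Ideal A} (hI : I.IsTwoSided) (hIo : IsOpen (I : Set A)) : ∃ n, x ^ n ∈ I := by
  have := h.finite_quotient hIo
  have : IsArtinianRing (A ⧸ I) := IsArtinianRing.of_finite k (A ⧸ I)
  have hmem : Ideal.Quotient.mk I x ∈ Ring.jacobson (A ⧸ I) := by
    rw [Ring.jacobson_eq_sInf_isMaximal, Submodule.mem_sInf]
    intro M hM
    have hM' : Ideal.IsMaximal M := hM
    have hmax : (Ideal.comap (Ideal.Quotient.mk I) M).IsMaximal :=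
      Ideal.comap_isMaximal_of_surjective _ Ideal.Quotient.mk_surjective
    refine mem_radical.1 hx _ hmax ?_
    refine AddSubgroup.isOpen_mono (H₁ := I.toAddSubgroup)
      (H₂ := (Ideal.comap (Ideal.Quotient.mk I) M).toAddSubgroup) (fun y hy => ?_) hIo
    change Ideal.Quotient.mk I y ∈ M
    rw [Ideal.Quotient.eq_zero_iff_mem.2 hy]
    exact M.zero_mem
  obtain ⟨n, hn⟩ := IsSemiprimaryRing.isNilpotent (R := A ⧸ I)
  refine ⟨n, Ideal.Quotient.eq_zero_iff_mem.1 ?_⟩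
  rw [map_pow]
  have := Ideal.pow_mem_pow hmem n
  rw [hn] at this
  exact this

/-- Sequences that are eventually constant modulo every open ideal converge. -/
theorem IsPseudocompact.exists_limit (h : IsPseudocompact k A) (s : ℕ → A)
    (hs : ∀ I : Ideal A, I.IsTwoSided → IsOpen (I : Set A) → ∃ N, ∀ n ≥ N, s n - s N ∈ I) :
    ∃ a : A, ∀ I : Ideal A, I.IsTwoSided → IsOpen (I : Set A) → ∃ N, ∀ n ≥ N, a - s n ∈ I := by
  classical
  choose! N hN using hs
  obtain ⟨a, ha⟩ := h.complete (fun I => s (N I)) (by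
    intro I K hI hK hIo hKo hIK
    have h1 := hIK (hN I hI hIo (max (N I) (N K)) (le_max_left _ _))
    have h2 := hN K hK hKo (max (N I) (N K)) (le_max_right _ _)
    simpa using K.sub_mem h2 h1)
  refine ⟨a, fun I hI hIo => ⟨N I, fun n hn => ?_⟩⟩
  simpa using I.sub_mem (ha I hI hIo) (hN I hI hIo n hn)

theorem IsPseudocompact.isUnit_one_add (h : IsPseudocompact k A) {w : A} (hw : w ∈ radical A) :
    IsUnit (1 + w) := by
  let s : ℕ → A := fun n => ∑ i ∈ Finset.range n, (-w) ^ i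
  have hpow : ∀ I : Ideal A, I.IsTwoSided → IsOpen (I : Set A) → ∃ N, ∀ n ≥ N, (-w) ^ n ∈ I := by
    intro I hI hIo
    obtain ⟨N, hN⟩ := h.nilpotent_mod ((radical A).neg_mem hw) hI hIo
    exact ⟨N, fun n hn => by
      rw [← Nat.sub_add_cancel hn, pow_add]; exact I.mul_mem_left _ hN⟩
  obtain ⟨a, ha⟩ := h.exists_limit s (by
    intro I hI hIo
    obtain ⟨N, hN⟩ := hpow I hI hIo
    refine ⟨N, fun n hn => ?_⟩
    simp only [s]
    rw [← Finset.sum_range_add_sum_Ico _ hn, add_sub_cancel_left]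
    exact I.sum_mem fun i hi => hN i (Finset.mem_Ico.1 hi).1)
  have e1 : ∀ n, s n * (1 + w) = 1 - (-w) ^ n := fun n => by
    have := geom_sum_mul_neg (-w) n
    simpa [s] using this
  have e2 : ∀ n, (1 + w) * s n = 1 - (-w) ^ n := fun n => by
    have := mul_neg_geom_sum (-w) n
    simpa [s] using this
  have l : a * (1 + w) = 1 := by
    refine sub_eq_zero.1 (h.eq_zero fun I hI hIo => ?_)
    obtain ⟨N, hN⟩ := ha I hI hIo
    obtain ⟨M, hM⟩ := hpow I hI hIo
    have h1 := I.mul_mem_right (1 + w) (hN (max N M) (le_max_left _ _))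
    have h2 := hM (max N M) (le_max_right _ _)
    rw [sub_mul, e1] at h1
    have := I.sub_mem h1 h2
    convert this using 1
    abel
  have r : (1 + w) * a = 1 := by
    refine sub_eq_zero.1 (h.eq_zero fun I hI hIo => ?_)
    obtain ⟨N, hN⟩ := ha I hI hIo
    obtain ⟨M, hM⟩ := hpow I hI hIo
    have h1 := I.mul_mem_left (1 + w) (hN (max N M) (le_max_left _ _))
    have h2 := hM (max N M) (le_max_right _ _)
    rw [mul_sub, e2] at h1
    have := I.sub_mem h1 h2
    convert this using 1
    abel
  exact ⟨⟨1 + w, a, r, l⟩, rfl⟩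

theorem IsPseudocompact.idem_eq_zero (h : IsPseudocompact k A) {e : A} (he : IsIdempotentElem e)
    (hJ : e ∈ radical A) : e = 0 := by
  refine h.eq_zero fun I hI hIo => ?_
  obtain ⟨n, hn⟩ := h.nilpotent_mod hJ hI hIo
  have := I.mul_mem_left e hn
  rwa [← pow_succ', he.pow_succ_eq] at this

/-- Lifting of idempotents modulo the radical, inside a corner `f A f`. -/
theorem IsPseudocompact.lift_idem (h : IsPseudocompact k A) {a : A}
    (ha : a * a - a ∈ radical A) :
    ∃ e : A, IsIdempotentElem e ∧ e - a ∈ radical A ∧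
      ∀ f : A, f * a = a → a * f = a → f * e = e ∧ e * f = e := by
  let p : A → A := fun x => 3 * (x * x) - 2 * (x * x * x)
  let s : ℕ → A := fun n => p^[n] a
  have s0 : s 0 = a := rfl
  have ss : ∀ n, s (n + 1) = p (s n) := fun n => Function.iterate_succ_apply' p n a
  have p1 : ∀ x : A, p x - x = (1 - 2 * x) * (x * x - x) := fun x => by
    simp only [p]; noncomm_ring
  have p2 : ∀ x : A, p x * p x - p x = (4 * (x * x - x) - 3) * (x * x - x) ^ 2 := fun x => by
    simp only [p]; noncomm_ring
  -- the defect of the `n`-th iterate is divisible by a high power of the defect of `a`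
  have hd : ∀ n, ∃ c, s n * s n - s n = c * (a * a - a) ^ (n + 1) ∧ Commute c a := by
    intro n
    have hc : ∀ n, Commute (s n) a := by
      intro n
      induction n with
      | zero => exact Commute.refl a
      | succ n ih =>
        rw [ss]
        exact ((Commute.ofNat_left 3 a).mul_left (ih.mul_left ih)).sub_left
          ((Commute.ofNat_left 2 a).mul_left ((ih.mul_left ih).mul_left ih))
    induction n with
    | zero => exact ⟨1, by simp [s0], Commute.one_left a⟩
    | succ n ih =>
      obtain ⟨c, hcn, hca⟩ := ih
      have hcd : Commute c (a * a - a) := (hca.mul_right hca).sub_right hca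
      refine ⟨(4 * (s n * s n - s n) - 3) * (c * c * (a * a - a) ^ n), ?_, ?_⟩
      · rw [ss, p2]
        conv_lhs => rw [hcn, (hcd.pow_right (n + 1)).mul_pow]
        rw [hcn]
        simp only [mul_assoc, ← pow_mul, ← pow_add, sq c]
        congr 4
        ring
      · have hsc := hc n
        have had : Commute (a * a - a) a :=
          ((Commute.refl a).mul_left (Commute.refl a)).sub_left (Commute.refl a)
        exact (((Commute.ofNat_left 4 a).mul_left ((hsc.mul_left hsc).sub_left hsc)).sub_left
          (Commute.ofNat_left 3 a)).mul_left ((hca.mul_left hca).mul_left (had.pow_left n))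
  have hdI : ∀ I : Ideal A, I.IsTwoSided → IsOpen (I : Set A) →
      ∃ N, ∀ n ≥ N, s n * s n - s n ∈ I := by
    intro I hI hIo
    obtain ⟨N, hN⟩ := h.nilpotent_mod ha hI hIo
    refine ⟨N, fun n hn => ?_⟩
    obtain ⟨c, hc, -⟩ := hd n
    rw [hc, ← Nat.sub_add_cancel (show N ≤ n + 1 by omega), pow_add, ← mul_assoc]
    exact I.mul_mem_left _ hN
  obtain ⟨e, he⟩ := h.exists_limit s (by
    intro I hI hIo
    obtain ⟨N, hN⟩ := hdI I hI hIo
    refine ⟨N, fun n hn => ?_⟩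
    induction n, hn using Nat.le_induction with
    | base => simp
    | succ n hn ih =>
      have h1 : s (n + 1) - s n ∈ I := by
        rw [ss, p1]; exact I.mul_mem_left _ (hN n hn)
      simpa using I.add_mem h1 ih)
  have hsJ : ∀ n, s n - a ∈ radical A := by
    intro n
    induction n with
    | zero => simp [s0]
    | succ n ih =>
      obtain ⟨c, hc, -⟩ := hd n
      have h1 : s (n + 1) - s n ∈ radical A := by
        rw [ss, p1, hc, pow_succ]
        exact Ideal.mul_mem_left _ _ (Ideal.mul_mem_left _ _ (Ideal.mul_mem_left _ _ ha))
      simpa using (radical A).add_mem h1 ih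
  refine ⟨e, ?_, ?_, ?_⟩
  · refine sub_eq_zero.1 (h.eq_zero fun I hI hIo => ?_)
    obtain ⟨N, hN⟩ := he I hI hIo
    obtain ⟨M, hM⟩ := hdI I hI hIo
    have h1 := hN (max N M) (le_max_left _ _)
    have h2 := hM (max N M) (le_max_right _ _)
    have h3 := I.add_mem (I.add_mem (I.mul_mem_left e h1)
      (I.mul_mem_right (s (max N M)) h1)) (I.sub_mem h2 h1)
    convert h3 using 1
    noncomm_ring
  · refine mem_radical.2 fun L hL hLo => ?_
    obtain ⟨I, ⟨hI, hIo, -⟩, hIL⟩ := h.basis.mem_iff.1 (hLo.mem_nhds L.zero_mem)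
    obtain ⟨N, hN⟩ := he I hI hIo
    have h1 : e - s N ∈ L := hIL (hN N le_rfl)
    simpa using L.add_mem h1 (mem_radical.1 (hsJ N) L hL hLo)
  · intro f hf1 hf2
    have hs : ∀ n, f * s n = s n ∧ s n * f = s n := by
      intro n
      induction n with
      | zero => exact ⟨hf1, hf2⟩
      | succ n ih =>
        rw [ss]
        have c3 : f * (3 : A) = 3 * f := (Commute.ofNat_right f 3).eq
        have c2 : f * (2 : A) = 2 * f := (Commute.ofNat_right f 2).eq
        constructor
        · simp only [p, mul_sub]
          rw [← mul_assoc, c3, ← mul_assoc f 2, c2]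
          simp only [mul_assoc]
          rw [← mul_assoc f, ih.1]
          rw [← mul_assoc f, ih.1]
        · simp only [p, sub_mul, mul_assoc, ih.2]
    constructor <;> refine sub_eq_zero.1 (h.eq_zero fun I hI hIo => ?_)
    · obtain ⟨N, hN⟩ := he I hI hIo
      have h1 := hN N le_rfl
      have h3 := I.sub_mem (I.mul_mem_left f h1) h1
      rw [mul_sub, (hs N).1] at h3
      simpa using h3
    · obtain ⟨N, hN⟩ := he I hI hIo
      have h1 := hN N le_rfl
      have h3 := I.sub_mem (I.mul_mem_right f h1) h1
      rw [sub_mul, (hs N).2] at h3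
      simpa using h3

/-! ### Characters of a pointed algebra -/

theorem IsPointed.exists_characters (h : IsPointed k A) :
    ∃ (ι : Type u) (χ : A →ₐ[k] (ι → k)), Function.Surjective χ ∧
      ∀ x, x ∈ radical A ↔ χ x = 0 := by
  obtain ⟨ι, ⟨φ⟩⟩ := h
  refine ⟨ι, φ.toAlgHom.comp (Ideal.Quotient.mkₐ k (radical A)),
    φ.surjective.comp Ideal.Quotient.mk_surjective, fun x => ?_⟩
  simp [Ideal.Quotient.eq_zero_iff_mem]

theorem finite_of_characters [Module.Finite k (A ⧸ radical A * radical A)] {ι : Type u}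
    (χ : A →ₐ[k] (ι → k)) (hχ : Function.Surjective χ)
    (hJ : ∀ x, x ∈ radical A ↔ χ x = 0) : Finite ι := by
  classical
  let f : (A ⧸ radical A * radical A) →ₗ[k] (ι → k) :=
    Submodule.liftQ ((radical A * radical A).restrictScalars k) χ.toLinearMap
      (fun x hx => (hJ x).1 (Ideal.mul_le_right hx))
  have hf : Function.Surjective f := fun v => by
    obtain ⟨a, rfl⟩ := hχ v
    exact ⟨Submodule.Quotient.mk a, rfl⟩
  have : Module.Finite k (ι → k) := Module.Finite.of_surjective f hf
  exact (Pi.linearIndependent_single_one ι k).finite_of_isNoetherian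

theorem isOpen_ker_character {ι : Type u}
    (χ : A →ₐ[k] (ι → k)) (hχ : Function.Surjective χ)
    (hJ : ∀ x, x ∈ radical A ↔ χ x = 0) (i : ι) : IsOpen {x : A | χ x i = 0} := by
  classical
  obtain ⟨b, hb⟩ := hχ (Pi.single i 1)
  have hbJ : b ∉ radical A := fun h => by
    have := congrFun (hb.symm.trans ((hJ b).1 h)) i
    simp at this
  obtain ⟨L, hL, hLo, hbL⟩ : ∃ L : Ideal A, L.IsMaximal ∧ IsOpen (L : Set A) ∧ b ∉ L := by
    by_contra! hcon
    exact hbJ (mem_radical.2 hcon)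
  let K : AddSubgroup A := (((Pi.evalAddMonoidHom (fun _ : ι => k) i).comp
    (χ : A →+* (ι → k)).toAddMonoidHom)).ker
  have hLK : L.toAddSubgroup ≤ K := by
    intro y hy
    by_contra hne
    have hc : χ y i ≠ 0 := hne
    refine hbL ?_
    have h1 : b - ((χ y i)⁻¹ • b) * y ∈ radical A := by
      rw [hJ, map_sub, map_mul, map_smul, hb]
      funext j
      by_cases hj : j = i
      · subst hj; simp [hc]
      · simp [hj]
    have h2 := L.add_mem (mem_radical.1 h1 L hL hLo) (L.mul_mem_left ((χ y i)⁻¹ • b) hy)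
    simpa using h2
  exact AddSubgroup.isOpen_mono hLK hLo

/-- Continuous homomorphisms into a pointed algebra map the radical into the radical. -/
theorem map_radical_le {B : Type u} [Ring B] [Algebra k B] [TopologicalSpace B]
    [IsTopologicalRing B] (hB : IsPointed k B) (α : A →ₐ[k] B) (hα : Continuous α) :
    radical A ≤ (radical B).comap (α : A →+* B) := by
  obtain ⟨ι, χ, hχ, hJ⟩ := hB.exists_characters
  intro x hx
  change α x ∈ radical B
  rw [hJ]
  funext i
  let ψ : A →ₐ[k] k := ((Pi.evalAlgHom k (fun _ : ι => k) i).comp χ).comp α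
  have hmax : (RingHom.ker ψ).IsMaximal :=
    RingHom.ker_isMaximal_of_surjective ψ fun c => ⟨algebraMap k A c, by simp⟩
  have hopen : IsOpen ((RingHom.ker ψ : Ideal A) : Set A) :=
    (isOpen_ker_character χ hχ hJ i).preimage hα
  exact mem_radical.1 hx _ hmax hopen

end Lemmas

/-! ### The categories of pointed algebras -/

/-- Objects of `PAlg`: pointed pseudocompact `k`-algebras `A` with `A / J²(A)` of finite
dimension, where `J²(A) = J(A) J(A)` is the product of ideals. -/
structure PAlg (k : Type u) [Field k] : Type (u + 1) where
  carrier : Type u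
  [ring : Ring carrier]
  [algebra : Algebra k carrier]
  [topologicalSpace : TopologicalSpace carrier]
  isPseudocompact : IsPseudocompact k carrier
  isPointed : haveI := isPseudocompact.isTopologicalRing; IsPointed k carrier
  finite_quotient : Module.Finite k (carrier ⧸ radical carrier * radical carrier)

namespace PAlg

attribute [instance] ring algebra topologicalSpace finite_quotient

variable {k : Type u} [Field k]

instance : CoeSort (PAlg k) (Type u) := ⟨carrier⟩

instance isTopologicalRing (A : PAlg k) : IsTopologicalRing A :=
  A.isPseudocompact.isTopologicalRing

/-- The homomorphism `A / J(A) → B / J(B)` induced by a continuous homomorphism `A → B`. -/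
def radicalQuotientMap {A B : PAlg k} (α : A →ₐ[k] B) (hα : Continuous α) :
    A ⧸ radical A →+* B ⧸ radical B :=
  Ideal.quotientMap (radical B) (α : A →+* B) (map_radical_le B.isPointed α hα)

/-- Morphisms of `PAlg`: continuous unital homomorphisms inducing a surjection between the
radical quotients `A / J(A) → B / J(B)`. -/
@[ext]
structure Hom (A B : PAlg k) : Type u where
  toAlgHom : A →ₐ[k] B
  continuous_toAlgHom : Continuous toAlgHom
  surjective_radicalQuotientMap :
    Function.Surjective (radicalQuotientMap toAlgHom continuous_toAlgHom)

theorem surjective_radicalQuotientMap_iff {A B : PAlg k} (α : A →ₐ[k] B) (hα : Continuous α) :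
    Function.Surjective (radicalQuotientMap α hα) ↔ ∀ b : B, ∃ a : A, b - α a ∈ radical B := by
  constructor
  · intro h b
    obtain ⟨q, hq⟩ := h (Ideal.Quotient.mk _ b)
    obtain ⟨a, rfl⟩ := Ideal.Quotient.mk_surjective q
    exact ⟨a, Ideal.Quotient.eq.1 hq.symm⟩
  · intro h q
    obtain ⟨b, rfl⟩ := Ideal.Quotient.mk_surjective q
    obtain ⟨a, ha⟩ := h b
    exact ⟨Ideal.Quotient.mk _ a, (Ideal.Quotient.eq.2 ha).symm⟩

theorem Hom.map_mem_radical {A B : PAlg k} (α : Hom A B) {x : A} (hx : x ∈ radical A) :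
    α.toAlgHom x ∈ radical B :=
  map_radical_le B.isPointed α.toAlgHom α.continuous_toAlgHom hx

instance : Category (PAlg k) where
  Hom := Hom
  id A :=
    { toAlgHom := AlgHom.id k A
      continuous_toAlgHom := continuous_id
      surjective_radicalQuotientMap :=
        (surjective_radicalQuotientMap_iff _ _).2 fun b => ⟨b, by simp⟩ }
  comp {A B C} α β :=
    { toAlgHom := β.toAlgHom.comp α.toAlgHom
      continuous_toAlgHom := β.continuous_toAlgHom.comp α.continuous_toAlgHom
      surjective_radicalQuotientMap := by
        refine (surjective_radicalQuotientMap_iff _ _).2 fun c => ?_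
        obtain ⟨b, hb⟩ := (surjective_radicalQuotientMap_iff _ _).1
          β.surjective_radicalQuotientMap c
        obtain ⟨a, ha⟩ := (surjective_radicalQuotientMap_iff _ _).1
          α.surjective_radicalQuotientMap b
        refine ⟨a, ?_⟩
        have := (radical C).add_mem hb (β.map_mem_radical ha)
        simpa using this }

@[simp] theorem id_toAlgHom (A : PAlg k) : Hom.toAlgHom (𝟙 A) = AlgHom.id k A := rfl

@[simp] theorem comp_toAlgHom {A B C : PAlg k} (α : A ⟶ B) (β : B ⟶ C) :
    Hom.toAlgHom (α ≫ β) = (Hom.toAlgHom β).comp (Hom.toAlgHom α) := rfl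

/-- The relation `α ∼₀ β` on parallel morphisms: `(α - β)(A) ⊆ J(B)`. -/
def sim0 (k : Type u) [Field k] : HomRel (PAlg k) := fun A B α β =>
  ∀ a : A, Hom.toAlgHom α a - Hom.toAlgHom β a ∈ radical B

instance sim0_congruence : Congruence (sim0 k) where
  equivalence :=
    { refl := fun α a => by simp
      symm := fun {α β} h a => by simpa using Submodule.neg_mem _ (h a)
      trans := fun {α β γ} h h' a => by simpa using Submodule.add_mem _ (h a) (h' a) }
  comp_left f _ _ h a := h (Hom.toAlgHom f a)
  comp_right g h a := by simpa using Hom.map_mem_radical g (h a)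

end PAlg

/-- The quotient category `PAlg₀ = PAlg / ∼₀`. -/
abbrev PAlg0 (k : Type u) [Field k] : Type (u + 1) := CategoryTheory.Quotient (PAlg.sim0 k)

/-- The canonical projection `Π₀ : PAlg ⥤ PAlg₀`. -/
abbrev proj0 (k : Type u) [Field k] : PAlg k ⥤ PAlg0 k :=
  CategoryTheory.Quotient.functor (PAlg.sim0 k)

/-! ### Pointed finite sets -/

/-- Objects of `PSet`: finite sets with a distinguished point `*`. -/
structure PSet : Type (u + 1) where
  carrier : Type u
  point : carrier
  [finite : Finite carrier]

namespace PSet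

attribute [instance] finite

instance : CoeSort PSet (Type u) := ⟨carrier⟩

/-- Morphisms of `PSet`: pointed maps that restrict to a bijection from the elements not mapping
to the point onto the elements different from the point. -/
@[ext]
structure Hom (Q R : PSet.{u}) : Type u where
  toFun : Q → R
  map_point : toFun Q.point = R.point
  bijOn : Set.BijOn toFun {x | toFun x ≠ R.point} {y | y ≠ R.point}

instance : Category PSet.{u} where
  Hom := Hom
  id Q := ⟨id, rfl, Set.bijOn_id _⟩
  comp {Q R S} f g :=
    { toFun := g.toFun ∘ f.toFun
      map_point := by simp [f.map_point, g.map_point]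
      bijOn := by
        have hne : ∀ x, g.toFun (f.toFun x) ≠ S.point → f.toFun x ≠ R.point := fun x hx h =>
          hx (by rw [h, g.map_point])
        refine ⟨fun x hx => hx, fun x hx y hy hxy => ?_, fun s hs => ?_⟩
        · exact f.bijOn.injOn (hne x hx) (hne y hy) (g.bijOn.injOn hx hy hxy)
        · obtain ⟨r, hr, rfl⟩ := g.bijOn.surjOn hs
          have hr' : r ≠ R.point := fun h => hr (by rw [h, g.map_point])
          obtain ⟨q, hq, rfl⟩ := f.bijOn.surjOn hr'
          exact ⟨q, hr, rfl⟩ }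

@[simp] theorem id_toFun (Q : PSet.{u}) : Hom.toFun (𝟙 Q) = id := rfl

@[simp] theorem comp_toFun {Q R S : PSet.{u}} (f : Q ⟶ R) (g : R ⟶ S) :
    Hom.toFun (f ≫ g) = Hom.toFun g ∘ Hom.toFun f := rfl

/-- The underlying set `Q₀` of `Q₀* = Q₀ ∪ {*}`. -/
abbrev Vertex (Q : PSet.{u}) : Type u := {x : Q // x ≠ Q.point}

/-- The unique preimage under `ρ` of an element different from the point. -/
def Hom.preimage {Q R : PSet.{u}} (ρ : Hom Q R) (r : R.Vertex) : Q.Vertex :=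
  ⟨(ρ.bijOn.surjOn r.2).choose, fun h =>
    (ρ.bijOn.surjOn r.2).choose_spec.1 (by rw [h, ρ.map_point])⟩

theorem Hom.map_preimage {Q R : PSet.{u}} (ρ : Hom Q R) (r : R.Vertex) :
    ρ.toFun (ρ.preimage r) = r :=
  (ρ.bijOn.surjOn r.2).choose_spec.2

theorem Hom.preimage_eq {Q R : PSet.{u}} (ρ : Hom Q R) {r : R.Vertex} {q : Q.Vertex}
    (h : ρ.toFun q = r) : ρ.preimage r = q := by
  refine Subtype.ext (ρ.bijOn.injOn ?_ ?_ ((ρ.map_preimage r).trans h.symm))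
  · change ρ.toFun _ ≠ _
    rw [ρ.map_preimage]; exact r.2
  · change ρ.toFun _ ≠ _
    rw [h]; exact r.2

end PSet

/-! ### The functor `k₀[[-]]` -/

section ProductAlgebra

variable (k : Type u) [Field k]

/-- The algebra `∏_{e ∈ Q₀} k`, with the discrete topology, as an object of `PAlg`. -/
def productAlgebra (Q : PSet.{u}) : PAlg k :=
  letI : TopologicalSpace (Q.Vertex → k) := ⊥
  haveI : DiscreteTopology (Q.Vertex → k) := ⟨rfl⟩
  haveI hfin : ∀ I : Ideal (Q.Vertex → k), Module.Finite k ((Q.Vertex → k) ⧸ I) := fun I =>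
    Module.Finite.of_surjective (I.mkQ.restrictScalars k) (Submodule.mkQ_surjective I)
  have hrad : radical (Q.Vertex → k) = ⊥ := by
    rw [eq_bot_iff]
    intro x hx
    rw [Ideal.mem_bot]
    funext q
    exact mem_radical.1 hx (RingHom.ker (Pi.evalRingHom (fun _ : Q.Vertex => k) q))
      (RingHom.ker_isMaximal_of_surjective _ (Function.surjective_eval q)) (isOpen_discrete _)
  { carrier := Q.Vertex → k
    isPseudocompact :=
      { isTopologicalRing := inferInstance
        t2Space := inferInstance
        basis := by
          rw [nhds_discrete]
          refine ⟨fun t => ⟨fun ht => ⟨⊥, ⟨inferInstance, isOpen_discrete _, hfin ⊥⟩, ?_⟩, ?_⟩⟩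
          · rintro x rfl
            exact ht
          · rintro ⟨I, -, hI⟩
            exact hI I.zero_mem
        complete := fun x hx => ⟨x ⊥, fun I hI hIo =>
          hx ⊥ I inferInstance hI (isOpen_discrete _) hIo bot_le⟩ }
    isPointed := ⟨Q.Vertex, ⟨(Ideal.quotientEquivAlgOfEq k hrad).trans (AlgEquiv.quotientBot k _)⟩⟩
    finite_quotient := hfin _ }

theorem radical_productAlgebra (Q : PSet.{u}) : radical (productAlgebra k Q) = ⊥ := by
  rw [eq_bot_iff]
  intro x hx
  rw [Ideal.mem_bot]
  funext q
  exact mem_radical.1 hx (RingHom.ker (Pi.evalRingHom (fun _ : Q.Vertex => k) q))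
    (RingHom.ker_isMaximal_of_surjective _ (Function.surjective_eval q)) trivial

/-- The homomorphism `∏_{Q₀} k → ∏_{R₀} k` induced by a map of pointed sets. On the standard basis
it sends `e` to `ρ e` if `ρ e ≠ *` and to `0` otherwise, see `productMap_single`. -/
def productMap {Q R : PSet.{u}} (ρ : PSet.Hom Q R) : (Q.Vertex → k) →ₐ[k] (R.Vertex → k) :=
  AlgHom.pi fun r => Pi.evalAlgHom k _ (ρ.preimage r)

open Classical in
theorem productMap_single {Q R : PSet.{u}} (ρ : PSet.Hom Q R) (e : Q.Vertex) :
    productMap k ρ (Pi.single e 1) =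
      if h : ρ.toFun e ≠ R.point then Pi.single ⟨ρ.toFun e, h⟩ 1 else 0 := by
  funext r
  change (Pi.single e (1 : k) : Q.Vertex → k) (ρ.preimage r) = _
  split_ifs with h
  · by_cases hr : r = ⟨ρ.toFun e, h⟩
    · subst hr
      rw [ρ.preimage_eq (q := e) rfl]
      simp
    · have : ρ.preimage r ≠ e := fun h' =>
        hr (Subtype.ext ((ρ.map_preimage r).symm.trans (congrArg (fun q => ρ.toFun q.1) h')))
      simp [hr, this]
  · have : ρ.preimage r ≠ e := fun h' => h (by rw [← h', ρ.map_preimage]; exact r.2)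
    simp [this]

theorem productMap_surjective {Q R : PSet.{u}} (ρ : PSet.Hom Q R) :
    Function.Surjective (productMap k ρ) := by
  classical
  intro v
  refine ⟨fun q => if h : ρ.toFun q ≠ R.point then v ⟨ρ.toFun q, h⟩ else 0, ?_⟩
  funext r
  change (if h : ρ.toFun (ρ.preimage r) ≠ R.point then v ⟨ρ.toFun (ρ.preimage r), h⟩ else 0) = v r
  have h : ρ.toFun (ρ.preimage r) ≠ R.point := by rw [ρ.map_preimage]; exact r.2
  rw [dif_pos h]
  congr 1
  exact Subtype.ext (ρ.map_preimage r)

/-- The functor `k₀[[-]] : PSet ⥤ PAlg`. -/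
def k0 : PSet.{u} ⥤ PAlg k where
  obj Q := productAlgebra k Q
  map {Q R} ρ :=
    { toAlgHom := productMap k ρ
      continuous_toAlgHom := continuous_bot
      surjective_radicalQuotientMap :=
        (PAlg.surjective_radicalQuotientMap_iff (A := productAlgebra k Q)
          (B := productAlgebra k R) _ _).2 fun b => by
            obtain ⟨a, ha⟩ := productMap_surjective k ρ b
            refine ⟨a, ?_⟩
            have h0 : b - (show productAlgebra k R from productMap k ρ a) = 0 :=
              sub_eq_zero.2 ha.symm
            exact (congrArg (· ∈ radical (productAlgebra k R)) h0).mpr (Submodule.zero_mem _) }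
  map_id Q := by
    refine PAlg.Hom.ext (AlgHom.ext fun v => funext fun q => ?_)
    exact congrArg v (PSet.Hom.preimage_eq _ rfl)
  map_comp {Q R S} f g := by
    refine PAlg.Hom.ext (AlgHom.ext fun v => funext fun s => ?_)
    refine congrArg v (PSet.Hom.preimage_eq _ ?_)
    change PSet.Hom.toFun g (PSet.Hom.toFun f _) = _
    rw [PSet.Hom.map_preimage, PSet.Hom.map_preimage]

/-- The functor `k̃₀[[-]] = Π₀ ∘ k₀[[-]] : PSet ⥤ PAlg₀`. -/
def k0Tilde : PSet.{u} ⥤ PAlg0 k := k0 k ⋙ proj0 k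

end ProductAlgebra

/-! ### Orbits of primitive idempotents -/

section Primitive

variable {A : Type u} [Ring A]

/-- A primitive idempotent: a non-zero idempotent that is not the sum of two non-zero orthogonal
idempotents. -/
structure IsPrimitiveIdempotent (e : A) : Prop where
  idem : IsIdempotentElem e
  ne_zero : e ≠ 0
  eq_zero_or_eq_zero : ∀ a b : A, IsIdempotentElem a → IsIdempotentElem b →
    a * b = 0 → b * a = 0 → e = a + b → a = 0 ∨ b = 0

variable [TopologicalSpace A] [IsTopologicalRing A]

/-- `e` and `f` lie in the same orbit of the group `𝒢(A)` of the conjugations by the units `1 + w`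
with `w ∈ J(A)`. -/
def RadicalConj (e f : A) : Prop :=
  ∃ w ∈ radical A, ∃ u : Aˣ, (u : A) = 1 + w ∧ f = u * e * (↑u⁻¹ : A)

theorem RadicalConj.equivalence : Equivalence (RadicalConj (A := A)) where
  refl e := ⟨0, (radical A).zero_mem, 1, by simp, by simp⟩
  symm := by
    rintro e f ⟨w, hw, u, hu, rfl⟩
    refine ⟨-((↑u⁻¹ : A) * w), (radical A).neg_mem ((radical A).mul_mem_left _ hw), u⁻¹, ?_, ?_⟩
    · have : w = u - 1 := by rw [hu]; abel
      rw [this, mul_sub]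
      simp
    · simp [mul_assoc]
  trans := by
    rintro e f g ⟨w, hw, u, hu, rfl⟩ ⟨z, hz, v, hv, rfl⟩
    refine ⟨w + z + z * w, (radical A).add_mem ((radical A).add_mem hw hz)
      ((radical A).mul_mem_left _ hw), v * u, ?_, ?_⟩
    · rw [Units.val_mul, hu, hv]
      noncomm_ring
    · simp [mul_assoc]

end Primitive

section CharactersIdempotents

variable {k : Type u} [Field k] {A : Type u} [Ring A] [Algebra k A] [TopologicalSpace A]
  [IsTopologicalRing A] {ι : Type u} {χ : A →ₐ[k] (ι → k)}

theorem character_idem {e : A} (he : IsIdempotentElem e) (i : ι) : χ e i = 0 ∨ χ e i = 1 := by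
  have : IsIdempotentElem (χ e i) := by
    have := congrFun (congrArg χ he.eq) i
    rwa [map_mul] at this
  exact IsIdempotentElem.iff_eq_zero_or_one.1 this

open Classical in
theorem isPrimitiveIdempotent_iff (h : IsPseudocompact k A) (hχ : Function.Surjective χ)
    (hJ : ∀ x, x ∈ radical A ↔ χ x = 0) {e : A} (he : IsIdempotentElem e) :
    IsPrimitiveIdempotent e ↔ ∃ i, χ e = Pi.single i 1 := by
  have hpos : ∀ {x : A}, IsIdempotentElem x → x ≠ 0 → ∃ i, χ x i = 1 := by
    intro x hx hx0
    by_contra! hcon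
    exact hx0 (h.idem_eq_zero hx ((hJ x).2 (funext fun i =>
      (character_idem hx i).resolve_right (hcon i))))
  constructor
  · intro hp
    obtain ⟨i, hi⟩ := hpos he hp.ne_zero
    obtain ⟨b, hb⟩ := hχ (Pi.single i 1)
    have hχa : χ (e * b * e) = Pi.single i 1 := by
      rw [map_mul, map_mul, hb]
      funext j
      by_cases hj : j = i
      · subst hj; simp [hi]
      · simp [hj]
    obtain ⟨f, hf, hfa, hfe⟩ := h.lift_idem (a := e * b * e) (by
      rw [hJ, map_sub, map_mul, hχa, ← Pi.single_mul]
      simp)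
    obtain ⟨h1, h2⟩ := hfe e (by simp only [← mul_assoc, he.eq]) (by rw [mul_assoc, he.eq])
    have hχf : χ f = Pi.single i 1 := by
      rw [hJ, map_sub, hχa, sub_eq_zero] at hfa
      exact hfa
    have hid : IsIdempotentElem (e - f) := by
      rw [IsIdempotentElem, mul_sub, sub_mul, sub_mul, he.eq, h1, h2, hf.eq]
      simp
    rcases hp.eq_zero_or_eq_zero f (e - f) hf hid (by rw [mul_sub, h2, hf.eq, sub_self])
      (by rw [sub_mul, h1, hf.eq, sub_self]) (by abel) with h0 | h0
    · rw [h0, map_zero] at hχf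
      have := congrFun hχf i
      simp at this
    · exact ⟨i, by rw [sub_eq_zero.1 h0, hχf]⟩
  · rintro ⟨i, hi⟩
    refine ⟨he, ?_, ?_⟩
    · rintro rfl
      have := congrFun hi i
      simp at this
    · intro a b ha hb hab hba hsum
      by_contra! hcon
      have key : ∀ {x y : A}, x * y = 0 → x + y = e → IsIdempotentElem x → x ≠ 0 →
          χ x i = 1 ∧ χ y i = 0 := by
        intro x y hxy hs hx hx0
        obtain ⟨j, hj⟩ := hpos hx hx0
        have h0 : χ y j = 0 := by
          have := congrFun (congrArg χ hxy) j
          simpa [hj] using this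
        have hji : j = i := by
          by_contra hne
          have := congrFun hi j
          rw [← hs, map_add, Pi.add_apply, hj, h0, Pi.single_eq_of_ne hne] at this
          simp at this
        subst hji
        exact ⟨hj, h0⟩
      have h1 := (key hab hsum.symm ha hcon.1).2
      have h2 := (key hba (by rw [hsum, add_comm]) hb hcon.2).1
      rw [h1] at h2
      exact zero_ne_one h2

theorem radicalConj_iff (h : IsPseudocompact k A) (hJ : ∀ x, x ∈ radical A ↔ χ x = 0)
    {e f : A} (he : IsIdempotentElem e) (hf : IsIdempotentElem f) :
    RadicalConj e f ↔ χ e = χ f := by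
  constructor
  · rintro ⟨w, hw, u, hu, rfl⟩
    have h1 : χ u * χ (↑u⁻¹ : A) = 1 := by rw [← map_mul]; simp
    rw [map_mul, map_mul, mul_right_comm, h1, one_mul]
  · intro hef
    have hw : f * e + (1 - f) * (1 - e) - 1 ∈ radical A := by
      rw [hJ]
      simp only [map_sub, map_add, map_mul, map_one, hef]
      have := congrArg χ hf.eq
      rw [map_mul] at this
      linear_combination 2 * this
    obtain ⟨u, hu⟩ := h.isUnit_one_add hw
    refine ⟨_, hw, u, hu, ?_⟩
    have hu' : (u : A) = f * e + (1 - f) * (1 - e) := by rw [hu]; abel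
    rw [Units.eq_mul_inv_iff_mul_eq, hu']
    simp only [mul_add, add_mul, mul_sub, sub_mul, mul_one, one_mul, mul_assoc, he.eq]
    simp only [← mul_assoc, hf.eq]
    abel

theorem exists_idem (h : IsPseudocompact k A)
    (hJ : ∀ x, x ∈ radical A ↔ χ x = 0) {a : A} (ha : χ a * χ a = χ a) :
    ∃ e, IsIdempotentElem e ∧ χ e = χ a := by
  obtain ⟨e, he, hea, -⟩ := h.lift_idem (a := a) (by rw [hJ, map_sub, map_mul, ha, sub_self])
  refine ⟨e, he, ?_⟩
  rwa [hJ, map_sub, sub_eq_zero] at hea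

end CharactersIdempotents

/-! ### The functor `GQ₀` -/

namespace PAlg

variable {k : Type u} [Field k]

/-- The primitive idempotents of `A`. -/
abbrev Primitive (A : PAlg k) : Type u := {e : A // IsPrimitiveIdempotent e}

/-- The orbit relation of `𝒢(A)` on the primitive idempotents of `A`. -/
instance orbitSetoid (A : PAlg k) : Setoid A.Primitive where
  r e f := RadicalConj (e : A) (f : A)
  iseqv :=
    { refl := fun _ => RadicalConj.equivalence.refl _
      symm := fun h => RadicalConj.equivalence.symm h
      trans := fun h h' => RadicalConj.equivalence.trans h h' }

/-- The set of `𝒢(A)`-orbits of primitive idempotents of `A`. -/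
abbrev Orbits (A : PAlg k) : Type u := _root_.Quotient A.orbitSetoid

instance finite_orbits (A : PAlg k) : Finite A.Orbits := by
  classical
  obtain ⟨ι, χ, hχ, hJ⟩ := A.isPointed.exists_characters
  have := finite_of_characters χ hχ hJ
  have hs : ∀ e : A.Primitive, ∃ i, χ (e : A) = Pi.single i 1 := fun e =>
    (isPrimitiveIdempotent_iff A.isPseudocompact hχ hJ e.2.idem).1 e.2
  choose i hi using hs
  refine Finite.of_injective (β := ι) (fun o => i o.out) fun o o' hoo => ?_
  have h1 : RadicalConj (o.out : A) (o'.out : A) := by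
    rw [radicalConj_iff A.isPseudocompact hJ o.out.2.idem o'.out.2.idem, hi, hi]
    exact congrArg (fun j => Pi.single j (1 : k)) hoo
  rw [← o.out_eq, ← o'.out_eq]
  exact Quotient.sound h1

/-- A morphism of `PAlg` maps a primitive idempotent to `0` or to a primitive idempotent. -/
theorem Hom.map_primitive {A B : PAlg k} (α : Hom A B) {e : A} (he : IsPrimitiveIdempotent e)
    (h0 : α.toAlgHom e ≠ 0) : IsPrimitiveIdempotent (α.toAlgHom e) := by
  classical
  obtain ⟨ι, χ, hχ, hJ⟩ := A.isPointed.exists_characters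
  obtain ⟨κ, ψ, hψ, hJ'⟩ := B.isPointed.exists_characters
  have hid : IsIdempotentElem (α.toAlgHom e) := he.idem.map α.toAlgHom
  rw [isPrimitiveIdempotent_iff B.isPseudocompact hψ hJ' hid]
  obtain ⟨i, hi⟩ := (isPrimitiveIdempotent_iff A.isPseudocompact hχ hJ he.idem).1 he
  obtain ⟨j, hj⟩ : ∃ j, ψ (α.toAlgHom e) j = 1 := by
    by_contra! hcon
    exact h0 (B.isPseudocompact.idem_eq_zero hid ((hJ' _).2 (funext fun j =>
      (character_idem hid j).resolve_right (hcon j))))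
  refine ⟨j, funext fun j' => ?_⟩
  by_cases hjj : j' = j
  · subst hjj; simp [hj]
  rw [Pi.single_eq_of_ne hjj]
  refine (character_idem hid j').resolve_right fun hj' => ?_
  obtain ⟨b, hb⟩ := hψ (Pi.single j 1)
  obtain ⟨x, hx⟩ := (surjective_radicalQuotientMap_iff _ _).1 α.surjective_radicalQuotientMap b
  have hψx : ψ (α.toAlgHom x) = Pi.single j 1 := by
    rw [hJ', map_sub, sub_eq_zero] at hx
    rw [← hx, hb]
  have hm : e * x - χ x i • e ∈ radical A := by
    rw [hJ, map_sub, map_mul, map_smul, hi]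
    funext l
    by_cases hl : l = i
    · subst hl; simp
    · simp [hl]
  have hm' := α.map_mem_radical hm
  rw [hJ', map_sub, map_mul, map_smul, map_sub, map_mul, map_smul, hψx] at hm'
  have e1 := congrFun hm' j
  have e2 := congrFun hm' j'
  simp [hj, hj', hjj] at e1 e2
  rw [e2] at e1
  simp at e1

theorem Hom.map_radicalConj {A B : PAlg k} (α : Hom A B) {e f : A} (h : RadicalConj e f) :
    RadicalConj (α.toAlgHom e) (α.toAlgHom f) := by
  obtain ⟨w, hw, u, hu, rfl⟩ := h
  refine ⟨α.toAlgHom w, α.map_mem_radical hw, Units.map (α.toAlgHom : A →* B) u, ?_, ?_⟩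
  · simp [hu]
  · rw [map_mul, map_mul]
    rfl

theorem Hom.map_eq_zero_iff {A B : PAlg k} (α : Hom A B) {e f : A} (h : RadicalConj e f) :
    α.toAlgHom e = 0 ↔ α.toAlgHom f = 0 := by
  have key : ∀ {x y : B}, RadicalConj x y → x = 0 → y = 0 := by
    rintro x y ⟨w, hw, u, hu, rfl⟩ rfl
    simp
  exact ⟨key (α.map_radicalConj h), key (RadicalConj.equivalence.symm (α.map_radicalConj h))⟩

/-- The pointed set `GQ₀(A)`: the orbits of primitive idempotents of `A`, together with an
additional point `none`. -/
def gq0Obj (A : PAlg k) : PSet.{u} where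
  carrier := Option A.Orbits
  point := none

open Classical in
/-- `GQ₀(α)` on an orbit: the orbit of `e` is sent to the orbit of `α e` if `α e ≠ 0`, and to the
point otherwise. -/
def gq0Orbit {A B : PAlg k} (α : Hom A B) : A.Orbits → Option B.Orbits :=
  Quotient.lift
    (fun e : A.Primitive =>
      if h : α.toAlgHom e = 0 then none
      else some (Quotient.mk B.orbitSetoid ⟨α.toAlgHom e, α.map_primitive e.2 h⟩))
    (by
      intro e f hef
      by_cases h : α.toAlgHom e = 0
      · simp only [h, (α.map_eq_zero_iff hef).1 h, dite_true]
      · have h' : ¬ α.toAlgHom f = 0 := fun h' => h ((α.map_eq_zero_iff hef).2 h')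
        simp only [h, h', dite_false]
        exact congrArg some (Quotient.sound (α.map_radicalConj hef)))

/-- `GQ₀(α)` as a map of pointed sets. -/
def gq0Fun {A B : PAlg k} (α : Hom A B) : Option A.Orbits → Option B.Orbits
  | none => none
  | some o => gq0Orbit α o

theorem gq0Fun_of_eq_zero {A B : PAlg k} (α : Hom A B) (e : A.Primitive)
    (h : α.toAlgHom e = 0) : gq0Fun α (some (Quotient.mk A.orbitSetoid e)) = none :=
  dif_pos h

theorem gq0Fun_of_ne_zero {A B : PAlg k} (α : Hom A B) (e : A.Primitive)
    (h : α.toAlgHom e ≠ 0) : gq0Fun α (some (Quotient.mk A.orbitSetoid e)) =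
      some (Quotient.mk B.orbitSetoid ⟨α.toAlgHom e, α.map_primitive e.2 h⟩) :=
  dif_neg h

theorem gq0Fun_injOn {A B : PAlg k} (α : Hom A B) :
    Set.InjOn (gq0Fun α) {x | gq0Fun α x ≠ none} := by
  classical
  obtain ⟨ι, χ, hχ, hJ⟩ := A.isPointed.exists_characters
  obtain ⟨κ, ψ, hψ, hJ'⟩ := B.isPointed.exists_characters
  rintro (_ | o) hx (_ | o') hy hxy
  · rfl
  · exact absurd rfl hx
  · exact absurd rfl hy
  obtain ⟨e, rfl⟩ := Quotient.mk_surjective o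
  obtain ⟨f, rfl⟩ := Quotient.mk_surjective o'
  change gq0Fun α (some (Quotient.mk A.orbitSetoid e)) ≠ none at hx
  change gq0Fun α (some (Quotient.mk A.orbitSetoid f)) ≠ none at hy
  change gq0Fun α (some (Quotient.mk A.orbitSetoid e)) =
    gq0Fun α (some (Quotient.mk A.orbitSetoid f)) at hxy
  have he : α.toAlgHom e ≠ 0 := fun h => hx (gq0Fun_of_eq_zero α e h)
  have hf : α.toAlgHom f ≠ 0 := fun h => hy (gq0Fun_of_eq_zero α f h)
  rw [gq0Fun_of_ne_zero α e he, gq0Fun_of_ne_zero α f hf, Option.some_inj] at hxy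
  have hc : RadicalConj (α.toAlgHom e) (α.toAlgHom f) := Quotient.exact hxy
  have pe := α.map_primitive e.2 he
  have pf := α.map_primitive f.2 hf
  rw [radicalConj_iff B.isPseudocompact hJ' pe.idem pf.idem] at hc
  obtain ⟨j, hj⟩ := (isPrimitiveIdempotent_iff B.isPseudocompact hψ hJ' pe.idem).1 pe
  obtain ⟨i, hi⟩ := (isPrimitiveIdempotent_iff A.isPseudocompact hχ hJ e.2.idem).1 e.2
  obtain ⟨i', hi'⟩ := (isPrimitiveIdempotent_iff A.isPseudocompact hχ hJ f.2.idem).1 f.2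
  have hii : i = i' := by
    by_contra hne
    have hm : (e : A) * (f : A) ∈ radical A := by
      rw [hJ, map_mul, hi, hi']
      funext l
      by_cases hl : l = i
      · subst hl; simp [hne]
      · simp [hl]
    have := congrFun ((hJ' _).1 (α.map_mem_radical hm)) j
    rw [map_mul, map_mul, ← hc, hj] at this
    simp at this
  refine congrArg some (Quotient.sound ?_)
  change RadicalConj (e : A) (f : A)
  rw [radicalConj_iff A.isPseudocompact hJ e.2.idem f.2.idem, hi, hi', hii]

theorem gq0Fun_surjOn {A B : PAlg k} (α : Hom A B) (o : B.Orbits) :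
    ∃ x, gq0Fun α x = some o := by
  classical
  obtain ⟨ι, χ, hχ, hJ⟩ := A.isPointed.exists_characters
  obtain ⟨κ, ψ, hψ, hJ'⟩ := B.isPointed.exists_characters
  have := finite_of_characters χ hχ hJ
  have := Fintype.ofFinite ι
  obtain ⟨f, rfl⟩ := Quotient.mk_surjective o
  obtain ⟨j, hj⟩ := (isPrimitiveIdempotent_iff B.isPseudocompact hψ hJ' f.2.idem).1 f.2
  have hlift : ∀ i : ι, ∃ e : A, IsIdempotentElem e ∧ χ e = Pi.single i 1 := by
    intro i
    obtain ⟨a, ha⟩ := hχ (Pi.single i 1)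
    obtain ⟨e, he, hea⟩ := exists_idem A.isPseudocompact hJ (a := a) (by
      rw [ha, ← Pi.single_mul, mul_one])
    exact ⟨e, he, hea.trans ha⟩
  choose e he hχe using hlift
  have hsum : (1 : A) - ∑ i, e i ∈ radical A := by
    rw [hJ, map_sub, map_one, map_sum]
    simp only [hχe]
    rw [sub_eq_zero]
    exact (Finset.univ_sum_single (1 : ι → k)).symm
  obtain ⟨i, hi⟩ : ∃ i, ψ (α.toAlgHom (e i)) j ≠ 0 := by
    by_contra! hcon
    have := congrFun ((hJ' _).1 (α.map_mem_radical hsum)) j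
    simp [hcon] at this
  have hp : IsPrimitiveIdempotent (e i) :=
    (isPrimitiveIdempotent_iff A.isPseudocompact hχ hJ (he i)).2 ⟨i, hχe i⟩
  have h0 : α.toAlgHom (e i) ≠ 0 := fun h => hi (by rw [h]; simp)
  have hp' := α.map_primitive hp h0
  refine ⟨some (Quotient.mk A.orbitSetoid ⟨e i, hp⟩), ?_⟩
  rw [gq0Fun_of_ne_zero α ⟨e i, hp⟩ h0]
  refine congrArg some (Quotient.sound ?_)
  change RadicalConj (α.toAlgHom (e i)) (f : B)
  rw [radicalConj_iff B.isPseudocompact hJ' hp'.idem f.2.idem, hj]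
  obtain ⟨j', hj'⟩ := (isPrimitiveIdempotent_iff B.isPseudocompact hψ hJ' hp'.idem).1 hp'
  rw [hj'] at hi ⊢
  have : j = j' := by
    by_contra hne
    exact hi (Pi.single_eq_of_ne hne 1)
  rw [this]

/-- `GQ₀(α)` as a morphism of `PSet`. -/
def gq0Map {A B : PAlg k} (α : Hom A B) : PSet.Hom A.gq0Obj B.gq0Obj where
  toFun := gq0Fun α
  map_point := rfl
  bijOn := by
    refine ⟨fun x hx => hx, gq0Fun_injOn α, fun y hy => ?_⟩
    cases y with
    | none => exact absurd rfl hy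
    | some o =>
      obtain ⟨x, hx⟩ := gq0Fun_surjOn α o
      refine ⟨x, ?_, hx⟩
      change gq0Fun α x ≠ none
      rw [hx]
      exact Option.some_ne_none o

end PAlg

section GQ0

variable (k : Type u) [Field k]

/-- The functor `GQ₀ : PAlg ⥤ PSet`. -/
def GQ0 : PAlg k ⥤ PSet.{u} where
  obj A := A.gq0Obj
  map α := PAlg.gq0Map α
  map_id A := by
    refine PSet.Hom.ext (funext fun x => ?_)
    rcases x with _ | o
    · rfl
    · obtain ⟨e, rfl⟩ := Quotient.mk_surjective o
      exact PAlg.gq0Fun_of_ne_zero (𝟙 A) e e.2.ne_zero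
  map_comp {A B C} α β := by
    refine PSet.Hom.ext (funext fun x => ?_)
    rcases x with _ | o
    · rfl
    obtain ⟨e, rfl⟩ := Quotient.mk_surjective o
    change PAlg.gq0Fun (α ≫ β) (some (Quotient.mk A.orbitSetoid e)) =
      PAlg.gq0Fun β (PAlg.gq0Fun α (some (Quotient.mk A.orbitSetoid e)))
    by_cases h : PAlg.Hom.toAlgHom α e = 0
    · rw [PAlg.gq0Fun_of_eq_zero α e h, PAlg.gq0Fun_of_eq_zero (α ≫ β) e (by simp [h])]
      rfl
    · rw [PAlg.gq0Fun_of_ne_zero α e h]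
      by_cases h' : PAlg.Hom.toAlgHom β (PAlg.Hom.toAlgHom α e) = 0
      · rw [PAlg.gq0Fun_of_eq_zero (α ≫ β) e h', PAlg.gq0Fun_of_eq_zero β _ h']
      · rw [PAlg.gq0Fun_of_ne_zero (α ≫ β) e h', PAlg.gq0Fun_of_ne_zero β _ h']
        rfl

theorem GQ0_map_eq_of_sim0 (A B : PAlg k) (α β : A ⟶ B) (h : PAlg.sim0 k α β) :
    (GQ0 k).map α = (GQ0 k).map β := by
  obtain ⟨κ, ψ, hψ, hJ⟩ := B.isPointed.exists_characters
  have hψe : ∀ a, ψ (PAlg.Hom.toAlgHom α a) = ψ (PAlg.Hom.toAlgHom β a) := fun a => by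
    have := (hJ _).1 (h a)
    rwa [map_sub, sub_eq_zero] at this
  have hc : ∀ e : A.Primitive,
      RadicalConj (PAlg.Hom.toAlgHom α (e : A)) (PAlg.Hom.toAlgHom β (e : A)) := fun e =>
    (radicalConj_iff B.isPseudocompact hJ (e.2.idem.map _) (e.2.idem.map _)).2 (hψe e)
  refine PSet.Hom.ext (funext fun x => ?_)
  rcases x with _ | o
  · rfl
  obtain ⟨e, rfl⟩ := Quotient.mk_surjective o
  change PAlg.gq0Fun α (some (Quotient.mk A.orbitSetoid e)) =
    PAlg.gq0Fun β (some (Quotient.mk A.orbitSetoid e))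
  obtain ⟨w, hw, u, hu, hue⟩ := hc e
  have hz : PAlg.Hom.toAlgHom α (e : A) = 0 ↔ PAlg.Hom.toAlgHom β (e : A) = 0 := by
    rw [hue]; simp
  by_cases h0 : PAlg.Hom.toAlgHom α (e : A) = 0
  · rw [PAlg.gq0Fun_of_eq_zero α e h0, PAlg.gq0Fun_of_eq_zero β e (hz.1 h0)]
  · rw [PAlg.gq0Fun_of_ne_zero α e h0, PAlg.gq0Fun_of_ne_zero β e (fun h => h0 (hz.2 h))]
    exact congrArg some (Quotient.sound (hc e))

/-- The functor `G̃Q₀ : PAlg₀ ⥤ PSet`, the factorization of `GQ₀` through `Π₀`. -/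
def GQ0Tilde : PAlg0 k ⥤ PSet.{u} :=
  CategoryTheory.Quotient.lift (PAlg.sim0 k) (GQ0 k) (GQ0_map_eq_of_sim0 k)

/-- The factorization `GQ₀ = G̃Q₀ ∘ Π₀`. -/
theorem proj0_comp_GQ0Tilde : proj0 k ⋙ GQ0Tilde k = GQ0 k :=
  CategoryTheory.Quotient.lift_spec _ _ _

end GQ0

end PointedAlg

end

/-! The algebra `A / J(A)` is a finite product of copies of `k`. Idempotents lift modulo `J(A)`, and
two idempotents with the same image are conjugate by some `1 + w` with `w ∈ J(A)`. So the factors of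
the product are indexed by the orbits of primitive idempotents, and reduction modulo `J(A)` becomes
a surjection `η_A : A → k₀[[GQ₀(A)]]` with kernel `J(A)`. This is the unit of the adjunction.

A morphism `Q₀* → R₀*` of `PSet` is the same thing as an injection `R₀ → Q₀`, given by the unique
preimages, and `k₀[[-]]` turns it into restriction of coordinates along that injection. Naturality
of `η` (`unit_naturality`) therefore says that the character of `B` at a vertex `v`, composed with
`α : A → B`, is the character of `A` at the preimage of `v` under `GQ₀(α)`. Modulo `J(A)` it is
enough to test this on primitive idempotents, where both sides are `0` or `1`.

The universal property is proved in `PAlg`: every `f : A → k₀[[Q]]` is `η_A ≫ k₀[[ρ]]` for exactly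
one `ρ`. Uniqueness holds because `η_A` is surjective and indicator functions recover the preimages.
For existence, the unit at `k₀[[Q]]` has a retraction of the form `k₀[[τ]]`
(`exists_unit_retraction`), and naturality gives `f = η_A ≫ k₀[[GQ₀(f) ≫ τ]]`.

Passing to `PAlg₀` changes nothing on these Hom sets: `k₀[[Q]]` has zero radical, so congruent
morphisms into it are equal, and `Π₀` is full. -/

noncomputable section

namespace PointedAlg

/-! ### Morphisms of pointed sets as injections in the opposite direction -/

namespace PSet

/-- The morphism of `PSet` that is inverse to an injection `R₀ → Q₀` on its range. -/
theorem exists_hom_of_injective {Q R : PSet.{u}} (σ : R.Vertex → Q.Vertex)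
    (hσ : Function.Injective σ) : ∃ ρ : Hom Q R, ∀ r, ρ.preimage r = σ r := by
  classical
  -- Everything off the range of `σ` goes to the point. This includes `Q.point`, since `σ` takes
  -- values in the vertices.
  let f : Q → R := fun x => if h : ∃ r, (σ r : Q) = x then (h.choose : R) else R.point
  have hf : ∀ r, f (σ r) = r := fun r => by
    have h : ∃ r', (σ r' : Q) = σ r := ⟨r, rfl⟩
    change (if h : ∃ r', (σ r' : Q) = σ r then (h.choose : R) else R.point) = r
    rw [dif_pos h]
    exact congrArg Subtype.val (hσ (Subtype.ext h.choose_spec))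
  have hf' : ∀ x, f x ≠ R.point → ∃ r, (σ r : Q) = x := fun x hx => by
    by_contra h
    exact hx (dif_neg h)
  let ρ : Hom Q R :=
    { toFun := f
      map_point := by
        by_contra h
        obtain ⟨r, hr⟩ := hf' _ h
        exact (σ r).2 hr
      bijOn := by
        refine ⟨fun x hx => hx, fun x hx y hy hxy => ?_, fun y hy => ?_⟩
        · obtain ⟨r, rfl⟩ := hf' x hx
          obtain ⟨s, rfl⟩ := hf' y hy
          rw [hf, hf] at hxy
          rw [Subtype.ext hxy]
        · refine ⟨σ ⟨y, hy⟩, ?_, hf ⟨y, hy⟩⟩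
          change f _ ≠ _
          rw [hf]
          exact hy }
  exact ⟨ρ, fun r => ρ.preimage_eq (hf r)⟩

/-- A morphism of `PSet` is determined by the preimages of the elements different from the
point. -/
theorem Hom.ext_preimage {Q R : PSet.{u}} {ρ τ : Hom Q R}
    (h : ∀ r, ρ.preimage r = τ.preimage r) : ρ = τ := by
  -- If `ρ x` is not the point, then `x` is its preimage under `ρ`, hence also under `τ`. The
  -- statement is kept general in `ρ` and `τ` because it is used again with the two exchanged.
  have key : ∀ {ρ τ : Hom Q R}, (∀ r, ρ.preimage r = τ.preimage r) →
      ∀ x, ρ.toFun x ≠ R.point → τ.toFun x = ρ.toFun x := by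
    intro ρ τ h x hx
    have hxQ : x ≠ Q.point := fun h0 => hx (by rw [h0, ρ.map_point])
    have h1 := ρ.preimage_eq (r := ⟨ρ.toFun x, hx⟩) (q := ⟨x, hxQ⟩) rfl
    have h2 := τ.map_preimage ⟨ρ.toFun x, hx⟩
    rwa [← h, h1] at h2
  refine Hom.ext (funext fun x => ?_)
  by_cases hx : ρ.toFun x = R.point
  · by_cases hx' : τ.toFun x = R.point
    · rw [hx, hx']
    · exact key (fun r => (h r).symm) x hx'
  · exact (key h x hx).symm

end PSet

/-! ### Characters indexed by orbits of primitive idempotents -/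

namespace PAlg

variable {k : Type u} [Field k]

open Classical in
/-- The characters of `A` are indexed by the orbits of primitive idempotents. -/
theorem exists_orbit_characters (A : PAlg k) :
    ∃ χ : A →ₐ[k] (A.Orbits → k), Function.Surjective χ ∧ (∀ x, x ∈ radical A ↔ χ x = 0) ∧
      ∀ e : A.Primitive, χ e = Pi.single (Quotient.mk A.orbitSetoid e) 1 := by
  obtain ⟨ι, χ, hχ, hJ⟩ := A.isPointed.exists_characters
  have hs : ∀ e : A.Primitive, ∃ i, χ (e : A) = Pi.single i 1 := fun e =>
    (isPrimitiveIdempotent_iff A.isPseudocompact hχ hJ e.2.idem).1 e.2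
  choose i hi using hs
  -- Conjugacy under `𝒢(A)` is equality of images under `χ`, and the image of `e` is the standard
  -- basis vector at `i e`. Hence `i` induces an injection on orbits.
  have hmk : ∀ e f : A.Primitive, Quotient.mk A.orbitSetoid e = Quotient.mk A.orbitSetoid f ↔
      i e = i f := by
    intro e f
    refine Quotient.eq.trans ((radicalConj_iff A.isPseudocompact hJ e.2.idem f.2.idem).trans ?_)
    rw [hi, hi]
    refine ⟨fun h => ?_, fun h => by rw [h]⟩
    by_contra hne
    have := congrFun h (i e)
    simp [hne] at this
  let j : A.Orbits → ι := Quotient.lift i fun e f hef => (hmk e f).1 (Quotient.sound hef)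
  have hj : Function.Bijective j := by
    constructor
    · rintro ⟨e⟩ ⟨f⟩ h
      exact (hmk e f).2 h
    · intro l
      -- Each index is attained: an idempotent lifting the standard basis vector at `l` is
      -- primitive.
      obtain ⟨b, hb⟩ := hχ (Pi.single l 1)
      obtain ⟨e, he, hea⟩ := exists_idem A.isPseudocompact hJ (a := b) (by
        rw [hb, ← Pi.single_mul, mul_one])
      have hel : χ e = Pi.single l 1 := hea.trans hb
      have hp : IsPrimitiveIdempotent e :=
        (isPrimitiveIdempotent_iff A.isPseudocompact hχ hJ he).2 ⟨l, hel⟩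
      refine ⟨Quotient.mk _ ⟨e, hp⟩, ?_⟩
      change i ⟨e, hp⟩ = l
      by_contra hne
      have := congrFun ((hi ⟨e, hp⟩).symm.trans hel) l
      simp [Ne.symm hne] at this
  -- The required map is `χ` with its coordinates reindexed along the bijection `j`.
  refine ⟨AlgHom.pi fun o => (Pi.evalAlgHom k _ (j o)).comp χ, fun v => ?_, fun x => ?_,
    fun e => ?_⟩
  · obtain ⟨a, ha⟩ := hχ (v ∘ (Equiv.ofBijective j hj).symm)
    refine ⟨a, funext fun o => ?_⟩
    change χ a (j o) = v o
    rw [ha]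
    exact congrArg v ((Equiv.ofBijective j hj).symm_apply_apply o)
  · rw [hJ]
    refine ⟨fun h => funext fun o => congrFun h (j o), fun h => funext fun l => ?_⟩
    obtain ⟨o, rfl⟩ := hj.2 l
    exact congrFun h o
  · funext o
    change χ e (j o) = _
    rw [hi]
    change (Pi.single (j (Quotient.mk _ e)) (1 : k) : ι → k) (j o) = _
    simp only [Pi.single_apply, hj.1.eq_iff]

/-- The characters of `A`, indexed by the orbits of primitive idempotents. -/
def orbitCharacter (A : PAlg k) : A →ₐ[k] (A.Orbits → k) := A.exists_orbit_characters.choose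

theorem orbitCharacter_surjective (A : PAlg k) : Function.Surjective A.orbitCharacter :=
  A.exists_orbit_characters.choose_spec.1

theorem mem_radical_iff_orbitCharacter (A : PAlg k) (x : A) :
    x ∈ radical A ↔ A.orbitCharacter x = 0 :=
  A.exists_orbit_characters.choose_spec.2.1 x

open Classical in
theorem orbitCharacter_primitive (A : PAlg k) (e : A.Primitive) :
    A.orbitCharacter e = Pi.single (Quotient.mk A.orbitSetoid e) 1 :=
  A.exists_orbit_characters.choose_spec.2.2 e

/-- The orbit belonging to an element of `GQ₀(A)` different from the point. -/
def vertexOrbit {A : PAlg k} (v : A.gq0Obj.Vertex) : A.Orbits :=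
  Option.get v.1 (Option.isSome_iff_ne_none.2 v.2)

theorem some_vertexOrbit {A : PAlg k} (v : A.gq0Obj.Vertex) :
    some (vertexOrbit v) = v.1 := Option.some_get _

/-- The element of `GQ₀(A)` given by an orbit. -/
def orbitVertex {A : PAlg k} (o : A.Orbits) : A.gq0Obj.Vertex :=
  ⟨some o, Option.some_ne_none o⟩

/-! ### Compatibility of the characters with morphisms -/

/-- Both sides are `0` or `1`. The left one is `1` exactly when `v` is the orbit of `α e`, the right
one exactly when the orbit of `e` is the preimage of `v`. These conditions agree because `GQ₀(α)` is
injective away from the fibre of the point; if `α e = 0`, neither holds. -/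
theorem orbitCharacter_map_primitive {A B : PAlg k} (α : Hom A B) (e : A.Primitive)
    (v : B.gq0Obj.Vertex) :
    B.orbitCharacter (α.toAlgHom e) (vertexOrbit v) =
      A.orbitCharacter e (vertexOrbit ((gq0Map α).preimage v)) := by
  classical
  have hp := (gq0Map α).map_preimage v
  change gq0Fun α ((gq0Map α).preimage v).1 = v.1 at hp
  rw [← some_vertexOrbit v, ← some_vertexOrbit ((gq0Map α).preimage v)] at hp
  rw [orbitCharacter_primitive, Pi.single_apply]
  by_cases h0 : α.toAlgHom e = 0
  · rw [h0, map_zero, if_neg]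
    · rfl
    · intro h
      rw [h, gq0Fun_of_eq_zero α e h0] at hp
      exact Option.some_ne_none _ hp.symm
  · have h1 := gq0Fun_of_ne_zero α e h0
    rw [B.orbitCharacter_primitive ⟨_, α.map_primitive e.2 h0⟩, Pi.single_apply]
    refine if_congr ⟨fun h => ?_, fun h => ?_⟩ rfl rfl
    · rw [← h, ← hp] at h1
      refine (Option.some_inj.1 (gq0Fun_injOn α ?_ ?_ h1)).symm
      · change gq0Fun α _ ≠ none
        rw [h1, hp]
        exact Option.some_ne_none _
      · change gq0Fun α _ ≠ none
        rw [hp]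
        exact Option.some_ne_none _
    · rw [h, h1] at hp
      exact (Option.some_inj.1 hp).symm

/-- Modulo `J(A)`, every element is a linear combination of primitive idempotents, one from each
orbit. Both sides are linear in `a` and vanish on `J(A)`, since `α` maps `J(A)` into `J(B)`; so the
case of a primitive idempotent suffices. -/
theorem orbitCharacter_map {A B : PAlg k} (α : Hom A B) (a : A) (v : B.gq0Obj.Vertex) :
    B.orbitCharacter (α.toAlgHom a) (vertexOrbit v) =
      A.orbitCharacter a (vertexOrbit ((gq0Map α).preimage v)) := by
  classical
  have := Fintype.ofFinite A.Orbits
  -- The coefficient of the chosen representative of the orbit `o` is the value of the character at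
  -- `o`, so `s` and `a` have the same characters.
  let s : A := ∑ o : A.Orbits, A.orbitCharacter a o • (o.out : A)
  have hs : a - s ∈ radical A := by
    rw [mem_radical_iff_orbitCharacter, map_sub, sub_eq_zero, map_sum]
    simp only [map_smul, orbitCharacter_primitive, Quotient.out_eq]
    funext o
    simp [Finset.sum_apply, Pi.single_apply]
  have h1 := congrFun ((A.mem_radical_iff_orbitCharacter _).1 hs)
    (vertexOrbit ((gq0Map α).preimage v))
  have h2 := congrFun ((B.mem_radical_iff_orbitCharacter _).1 (α.map_mem_radical hs))
    (vertexOrbit v)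
  rw [map_sub, Pi.sub_apply, Pi.zero_apply, sub_eq_zero] at h1
  rw [map_sub, map_sub, Pi.sub_apply, Pi.zero_apply, sub_eq_zero] at h2
  rw [h1, h2]
  simp only [s, map_sum, map_smul, Finset.sum_apply, Pi.smul_apply, orbitCharacter_map_primitive]

/-! ### The unit -/

/-- The underlying homomorphism `A → ∏ k` of the unit, the product over the orbits. -/
def unitAlgHom (A : PAlg k) : A →ₐ[k] (A.gq0Obj.Vertex → k) :=
  AlgHom.pi fun v => (Pi.evalAlgHom k _ (vertexOrbit v)).comp A.orbitCharacter

theorem unitAlgHom_surjective (A : PAlg k) : Function.Surjective A.unitAlgHom := by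
  intro v
  obtain ⟨a, ha⟩ := A.orbitCharacter_surjective fun o => v (orbitVertex o)
  refine ⟨a, funext fun w => ?_⟩
  change A.orbitCharacter a (vertexOrbit w) = v w
  rw [ha]
  exact congrArg v (Subtype.ext (some_vertexOrbit w))

/-- The radical is the intersection of the kernels of the characters, which are open, and there are
only finitely many orbits. -/
theorem isOpen_radical (A : PAlg k) : IsOpen (radical A : Set A) := by
  have : (radical A : Set A) = ⋂ o, {x : A | A.orbitCharacter x o = 0} := by
    ext x
    simp only [SetLike.mem_coe, mem_radical_iff_orbitCharacter, Set.mem_iInter, Set.mem_ofPred_eq]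
    exact funext_iff
  rw [this]
  exact isOpen_iInter_of_finite fun o =>
    isOpen_ker_character A.orbitCharacter A.orbitCharacter_surjective
      A.mem_radical_iff_orbitCharacter o

/-- The map is constant on the open neighbourhood `J(A)` of `0`, and continuity of an additive map
need only be checked at `0`. -/
theorem continuous_unitAlgHom (A : PAlg k) :
    Continuous (X := A) (Y := productAlgebra k A.gq0Obj) A.unitAlgHom := by
  let f : A →ₐ[k] productAlgebra k A.gq0Obj := A.unitAlgHom
  refine continuous_of_continuousAt_zero f ?_
  intro s hs
  refine Filter.mem_map.2 <| Filter.mem_of_superset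
    (A.isOpen_radical.mem_nhds (radical A).zero_mem) fun x hx => ?_
  have h0 : f x = f 0 := funext fun v => by
    change A.orbitCharacter x (vertexOrbit v) = A.orbitCharacter 0 (vertexOrbit v)
    rw [(A.mem_radical_iff_orbitCharacter x).1 hx, map_zero]
  rw [Set.mem_preimage, h0]
  exact mem_of_mem_nhds hs

/-- The unit `A → k₀[[GQ₀(A)]]`. -/
def unit (A : PAlg k) : A ⟶ (k0 k).obj ((GQ0 k).obj A) where
  toAlgHom := A.unitAlgHom
  continuous_toAlgHom := A.continuous_unitAlgHom
  surjective_radicalQuotientMap :=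
    (surjective_radicalQuotientMap_iff (A := A) (B := productAlgebra k A.gq0Obj) _ _).2
      fun b => by
        obtain ⟨a, ha⟩ := A.unitAlgHom_surjective b
        refine ⟨a, ?_⟩
        have h0 : b - (show productAlgebra k A.gq0Obj from A.unitAlgHom a) = 0 :=
          sub_eq_zero.2 ha.symm
        exact (congrArg (· ∈ radical (productAlgebra k A.gq0Obj)) h0).mpr (Submodule.zero_mem _)

theorem unit_naturality {A B : PAlg k} (α : A ⟶ B) :
    α ≫ B.unit = A.unit ≫ (k0 k).map ((GQ0 k).map α) :=
  Hom.ext (AlgHom.ext fun a => funext fun v => orbitCharacter_map α a v)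

/-! ### The universal property of the unit -/

/-- Congruent morphisms into a product algebra are equal. -/
theorem eq_of_sim0 {A : PAlg k} {Q : PSet.{u}} {α β : A ⟶ (k0 k).obj Q} (h : sim0 k α β) :
    α = β := by
  refine Hom.ext (AlgHom.ext fun a => ?_)
  have h1 : ∀ x : productAlgebra k Q, x ∈ radical (productAlgebra k Q) → x = 0 := fun x hx => by
    rwa [radical_productAlgebra, Submodule.mem_bot] at hx
  exact sub_eq_zero.1 (h1 _ (h a))

theorem unit_comp_map_injective (A : PAlg k) (Q : PSet.{u}) :
    Function.Injective fun ρ : (GQ0 k).obj A ⟶ Q => A.unit ≫ (k0 k).map ρ := by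
  classical
  intro (ρ : PSet.Hom A.gq0Obj Q) (τ : PSet.Hom A.gq0Obj Q) h
  refine PSet.Hom.ext_preimage fun r => ?_
  -- Coordinate `r` of the two composites reads off the unit at `ρ.preimage r` and at `τ.preimage
  -- r`; an indicator function at the first tells these apart.
  obtain ⟨a, ha⟩ := A.unitAlgHom_surjective (Pi.single (ρ.preimage r) 1)
  have h1 : A.unitAlgHom a (ρ.preimage r) = A.unitAlgHom a (τ.preimage r) :=
    congrFun (congrArg (fun f : A ⟶ (k0 k).obj Q => Hom.toAlgHom f a) h) r
  rw [ha, Pi.single_eq_same, Pi.single_apply] at h1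
  by_contra hne
  rw [if_neg (Ne.symm hne)] at h1
  exact one_ne_zero h1

theorem isPrimitiveIdempotent_single {Q : PSet.{u}} [DecidableEq Q.Vertex] (q : Q.Vertex) :
    IsPrimitiveIdempotent (A := productAlgebra k Q) (Pi.single q (1 : k) : Q.Vertex → k) := by
  classical
  have hid : IsIdempotentElem (Pi.single q (1 : k) : Q.Vertex → k) := by
    rw [IsIdempotentElem, ← Pi.single_mul, mul_one]
  -- Since the radical is zero, the identity of `∏ k` serves as the family of characters in the
  -- criterion.
  refine (isPrimitiveIdempotent_iff (A := productAlgebra k Q)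
    (χ := AlgHom.id k (Q.Vertex → k)) (productAlgebra k Q).isPseudocompact
    Function.surjective_id (fun x => ?_) hid).2 ⟨q, ?_⟩
  · exact (congrArg (x ∈ ·) (radical_productAlgebra k Q)).to_iff.trans (Submodule.mem_bot _)
  · change Pi.single q 1 = _
    -- The two sides differ only in the decidability instance inside `Pi.single`.
    congr!

/-- The morphism `τ` plays the role of the counit: its preimages send a vertex `q` to the orbit of
the standard idempotent at `q`. Injectivity of this assignment is enough to define `τ`. -/
theorem exists_unit_retraction (Q : PSet.{u}) :
    ∃ τ : (GQ0 k).obj ((k0 k).obj Q) ⟶ Q, ((k0 k).obj Q).unit ≫ (k0 k).map τ = 𝟙 _ := by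
  classical
  let P : PAlg k := productAlgebra k Q
  let e : Q.Vertex → P.Primitive := fun q => ⟨_, isPrimitiveIdempotent_single q⟩
  let σ : Q.Vertex → P.gq0Obj.Vertex := fun q => orbitVertex (Quotient.mk P.orbitSetoid (e q))
  -- With `e q` the standard idempotent, `x * e q = x q • e q`. Applying the character at the orbit
  -- of `e q`, whose value on `e q` is `1`, shows that this character is evaluation at `q`.
  have hσ : ∀ (x : Q.Vertex → k) (q : Q.Vertex), P.unitAlgHom x (σ q) = x q := by
    intro x q
    have h1 : x * Pi.single q 1 = x q • (Pi.single q 1 : Q.Vertex → k) := by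
      funext r
      by_cases hr : r = q
      · subst hr; simp
      · simp [hr]
    have h2 : P.orbitCharacter (e q) (Quotient.mk P.orbitSetoid (e q)) = 1 := by
      rw [orbitCharacter_primitive, Pi.single_eq_same]
    have h3 : P.orbitCharacter x * P.orbitCharacter (e q) =
        x q • P.orbitCharacter (e q) :=
      (map_mul P.orbitCharacter _ _).symm.trans
        ((congrArg P.orbitCharacter h1).trans (map_smul P.orbitCharacter _ _))
    have h4 := congrFun h3 (Quotient.mk P.orbitSetoid (e q))
    rw [Pi.mul_apply, Pi.smul_apply, h2, mul_one, smul_eq_mul, mul_one] at h4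
    exact h4
  have hinj : Function.Injective σ := by
    intro q r h
    have h1 := hσ (Pi.single q 1) q
    have h2 := hσ (Pi.single q 1) r
    rw [← h, h1, Pi.single_eq_same, Pi.single_apply] at h2
    by_contra hne
    rw [if_neg (Ne.symm hne)] at h2
    exact one_ne_zero h2
  obtain ⟨τ, hτ⟩ := PSet.exists_hom_of_injective σ hinj
  refine ⟨τ, Hom.ext (AlgHom.ext fun x => funext fun q => ?_)⟩
  change P.unitAlgHom x (τ.preimage q) = x q
  rw [hτ]
  exact hσ x q

theorem unit_comp_map_surjective (A : PAlg k) (Q : PSet.{u}) :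
    Function.Surjective fun ρ : (GQ0 k).obj A ⟶ Q => A.unit ≫ (k0 k).map ρ := by
  intro f
  obtain ⟨τ, hτ⟩ := exists_unit_retraction (k := k) Q
  -- The transpose of `f`, with `τ` as counit. By naturality the composite becomes `f` followed by
  -- the unit at `k₀[[Q]]` and its retraction.
  refine ⟨(GQ0 k).map f ≫ τ, ?_⟩
  change A.unit ≫ (k0 k).map ((GQ0 k).map f ≫ τ) = f
  rw [Functor.map_comp, ← Category.assoc, ← unit_naturality, Category.assoc, hτ,
    Category.comp_id]

end PAlg

/-! ### Descent to the quotient category and the adjunction -/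

section Adjunction

variable (k : Type u) [Field k]

/-- The unit of the adjunction between `G̃Q₀` and `k̃₀[[-]]`. -/
def unitTilde (X : PAlg0 k) : X ⟶ (k0Tilde k).obj ((GQ0Tilde k).obj X) :=
  (proj0 k).map X.as.unit

theorem unitTilde_naturality {X Y : PAlg0 k} (f : X ⟶ Y) :
    f ≫ unitTilde k Y = unitTilde k X ≫ (k0Tilde k).map ((GQ0Tilde k).map f) := by
  obtain ⟨A⟩ := X
  obtain ⟨B⟩ := Y
  obtain ⟨α, rfl⟩ := (proj0 k).map_surjective (X := A) (Y := B) f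
  have h := congrArg (proj0 k).map (PAlg.unit_naturality α)
  rwa [Functor.map_comp, Functor.map_comp] at h

/-- Injectivity: as `∼₀` is a congruence, equality in `PAlg₀` means `∼₀`, which is equality for
morphisms into `k₀[[Q]]`. Surjectivity: `Π₀` is full, so a representative can be factored in `PAlg`.
-/
theorem unitTilde_comp_map_bijective (X : PAlg0 k) (Q : PSet.{u}) :
    Function.Bijective fun ρ : (GQ0Tilde k).obj X ⟶ Q => unitTilde k X ≫ (k0Tilde k).map ρ := by
  obtain ⟨A⟩ := X
  constructor
  · intro ρ τ h
    refine PAlg.unit_comp_map_injective A Q (PAlg.eq_of_sim0 ?_)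
    refine (Quotient.functor_map_eq_iff (PAlg.sim0 k) _ _).1 ?_
    rw [Functor.map_comp, Functor.map_comp]
    exact h
  · intro f
    obtain ⟨α, rfl⟩ := (proj0 k).map_surjective (X := A) (Y := (k0 k).obj Q) f
    obtain ⟨ρ, rfl⟩ := PAlg.unit_comp_map_surjective A Q α
    exact ⟨ρ, ((proj0 k).map_comp _ _).symm⟩

/-- The bijection of the adjunction between `G̃Q₀` and `k̃₀[[-]]`. -/
def adjunctionHomEquiv (X : PAlg0 k) (Q : PSet.{u}) :
    ((GQ0Tilde k).obj X ⟶ Q) ≃ (X ⟶ (k0Tilde k).obj Q) :=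
  Equiv.ofBijective _ (unitTilde_comp_map_bijective k X Q)

theorem adjunctionHomEquiv_apply (X : PAlg0 k) (Q : PSet.{u}) (ρ : (GQ0Tilde k).obj X ⟶ Q) :
    adjunctionHomEquiv k X Q ρ = unitTilde k X ≫ (k0Tilde k).map ρ := rfl

theorem adjunctionHomEquiv_naturality_left {X Y : PAlg0 k} {Q : PSet.{u}}
    (f : X ⟶ Y) (ρ : (GQ0Tilde k).obj Y ⟶ Q) :
    adjunctionHomEquiv k X Q ((GQ0Tilde k).map f ≫ ρ) = f ≫ adjunctionHomEquiv k Y Q ρ := by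
  rw [adjunctionHomEquiv_apply, adjunctionHomEquiv_apply, Functor.map_comp, ← Category.assoc,
    ← unitTilde_naturality, Category.assoc]

/-- The adjunction between `G̃Q₀` and `k̃₀[[-]]`. -/
def adjunction : GQ0Tilde k ⊣ k0Tilde k :=
  Adjunction.mkOfHomEquiv
    { homEquiv := adjunctionHomEquiv k
      homEquiv_naturality_left_symm := fun f g => by
        rw [Equiv.symm_apply_eq, adjunctionHomEquiv_naturality_left, Equiv.apply_symm_apply]
      homEquiv_naturality_right := fun f g => by
        rw [adjunctionHomEquiv_apply, adjunctionHomEquiv_apply, Functor.map_comp, Category.assoc] }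

end Adjunction

end PointedAlg

end

theorem mainTheorem7 (k : Type u) [Field k] [PerfectField k] :
    Nonempty (PointedAlg.GQ0Tilde k ⊣ PointedAlg.k0Tilde k) :=
  ⟨PointedAlg.adjunction k⟩
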